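/- Let $1\le m<n$. Exactly $n$ rankable objects appear one at a time, at times $1,\dots,n$, in an order uniformly distributed over all $n!$ orders; at time $t$ only the relative ranks of the objects presented so far are observed. An object is a candidate if it is the best of those presented so far. For $1\le i\le n$ let $\mathcal T_n(i)$ be the time of the first candidate after time $i$, or $n+1$ if there is none, and let $D_n(i)=\mathcal T_n(i)-i$ be the duration of a candidate selected at time $i$; put $D_n(n+1)=0$. In the $m$-choice duration problem one selects at most $m$ candidates, at successive times $\tau_1<\tau_2<\cdots$ which are stopping times with respect to the observed relative ranks (with $\tau_j=n+1$ for a choice that is not used), so as to maximize $\mathbf E\sum_{j=1}^m D_n(\tau_j)$. For $1\le i\le n$ put $$G^{(1)}_i=\tfrac1i\bigl(U^{(1)}_i-\widetilde V^{(1)}_i\bigr),$$ where $U^{(1)}_i$ and $\widetilde V^{(1)}_i$ are the conditional expectations of $D_n(i)$ and of $D_n(\mathcal T_n(i))$, given that the $i$-th object is a candidate. Define recursively, for $k\ge1$, $$s_k=\min\{i: 1\le i\le n,\ G^{(k)}_i\ge 0\},\qquad G^{(k+1)}_i=G^{(1)}_i+\sum_{j=\max(i+1,\,s_k)}^{n}\frac{1}{j-1}\,G^{(k)}_j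 .$$ Then $s_1,\dots,s_m$ are well defined (the minima are over nonempty sets), $s_1\ge s_2\ge\cdots\ge s_m$, and the following strategy is optimal in the $m$-choice duration problem: whenever $k$ choices $(1\le k\le m)$ remain to be made, select immediately the first candidate, if any, to appear at or after time $s_k$. Moreover, this strategy is optimal from every state on: for all $1\le i\le n$ and $1\le k\le m$, when $k$ choices remain and the decision about the $i$-th object is due, following it from time $i$ on maximizes the conditional expected total duration of the objects selected at times $\ge i$, given the relative ranks observed up to time $i$, whatever these are. -/

import Mathlib

open MeasureTheory ProbabilityTheory

namespace DurationProblem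

/-- Every event about the order of presentation of the `n` objects is measurable. -/
instance instMeasurableSpaceOrder (n : ℕ) : MeasurableSpace (Equiv.Perm (Fin n)) := ⊤

/-- The law of the arrival order: all `n!` orders are equally likely. An order `σ` assigns to the
index `i` the absolute rank `σ i` (`0` is best) of the object that is presented at time `i + 1`. -/
noncomputable def orderLaw (n : ℕ) : Measure (Equiv.Perm (Fin n)) := uniformOn Set.univ

/-- Relative rank of the object at index `i` amongst the objects presented up to then
(`1` means relatively best). -/
def relRank {n : ℕ} (σ : Equiv.Perm (Fin n)) (i : Fin n) : ℕ :=
  (Finset.univ.filter fun j : Fin n => j ≤ i ∧ σ j ≤ σ i).card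

/-- A candidate (relatively best object) appears at time `t`, where `1 ≤ t ≤ n`. -/
def IsCandidate {n : ℕ} (σ : Equiv.Perm (Fin n)) (t : ℕ) : Prop :=
  ∃ i : Fin n, (i : ℕ) + 1 = t ∧ relRank σ i = 1

/-- Time of the first candidate to appear at or after time `a`; it is `n + 1` if there is none. -/
noncomputable def firstCandidateFrom {n : ℕ} (σ : Equiv.Perm (Fin n)) (a : ℕ) : ℕ :=
  sInf {t | (a ≤ t ∧ IsCandidate σ t) ∨ t = n + 1}

/-- Time of the first candidate after time `t`; it is `n + 1` if there is none. -/
noncomputable def nextCandidate {n : ℕ} (σ : Equiv.Perm (Fin n)) (t : ℕ) : ℕ :=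
  firstCandidateFrom σ (t + 1)

/-- Duration of the candidate selected at time `t`. Time `n + 1` stands for a choice that is not
used; its duration is `0`. -/
noncomputable def duration {n : ℕ} (σ : Equiv.Perm (Fin n)) (t : ℕ) : ℕ :=
  nextCandidate σ t - t

/-- The relative ranks observed up to time `t`. -/
def history (n t : ℕ) (σ : Equiv.Perm (Fin n)) : {i : Fin n // (i : ℕ) + 1 ≤ t} → ℕ :=
  fun i => relRank σ i

/-- The information available to the decision maker: at time `t` the σ-algebra generated by the
relative ranks of the objects presented up to time `t`. -/
def rankFiltration (n : ℕ) : Filtration ℕ (instMeasurableSpaceOrder n) where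
  seq t := MeasurableSpace.comap (history n t) ⊤
  mono' := by
    rintro s t hst _ ⟨B, -, rfl⟩
    refine ⟨{h | (fun i : {i : Fin n // (i : ℕ) + 1 ≤ s} => h ⟨i.1, i.2.trans hst⟩) ∈ B},
      trivial, ?_⟩
    rfl
  le' := fun _ _ _ => trivial

/-- Admissible continuations from time `i` on when `k` choices remain: vectors of `k` stopping
times with values in `{i, …, n + 1}`, the value `n + 1` meaning that the choice is not used;
only candidates may be chosen, and different choices are made at successive times. -/
structure IsAdmissible (n i k : ℕ) (τ : Fin k → Equiv.Perm (Fin n) → ℕ) : Prop where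
  stopping : ∀ j, IsStoppingTime (rankFiltration n) fun σ => ((τ j σ : ℕ) : WithTop ℕ)
  ge_start : ∀ j σ, i ≤ τ j σ
  candidate : ∀ j σ, IsCandidate σ (τ j σ) ∨ τ j σ = n + 1
  increasing : ∀ j l, j < l → ∀ σ, τ j σ < τ l σ ∨ τ l σ = n + 1

/-- Total time of possession of relatively best objects. -/
noncomputable def payoff {n k : ℕ} (τ : Fin k → Equiv.Perm (Fin n) → ℕ)
    (σ : Equiv.Perm (Fin n)) : ℝ :=
  ∑ j, (duration σ (τ j σ) : ℝ)

/-- `τ` solves the `k`-choice duration problem with exactly `n` objects. -/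
def IsOptimal (n k : ℕ) (τ : Fin k → Equiv.Perm (Fin n) → ℕ) : Prop :=
  IsAdmissible n 1 k τ ∧
    ∀ τ', IsAdmissible n 1 k τ' → ∫ σ, payoff τ' σ ∂(orderLaw n) ≤ ∫ σ, payoff τ σ ∂(orderLaw n)

/-- `τ` is an optimal continuation when the decision about the object at time `i` is due and `k`
choices remain, whatever relative ranks have been observed up to time `i`. -/
def IsOptimalFrom (n i k : ℕ) (τ : Fin k → Equiv.Perm (Fin n) → ℕ) : Prop :=
  IsAdmissible n i k τ ∧
    ∀ τ', IsAdmissible n i k τ' →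
      (orderLaw n)[payoff τ' | rankFiltration n i]
        ≤ᵐ[orderLaw n] (orderLaw n)[payoff τ | rankFiltration n i]

/-- Times (indexed by `j = 0, 1, …`) of the choices made, from time `i` on with `k` choices left,
by the rule which, whenever `l` choices are left, selects the first candidate to appear at or
after time `s l`. -/
noncomputable def thresholdTime {n : ℕ} (s : ℕ → ℕ) (i k : ℕ) (σ : Equiv.Perm (Fin n)) : ℕ → ℕ
  | 0 => firstCandidateFrom σ (max i (s k))
  | j + 1 => firstCandidateFrom σ (max (thresholdTime s i k σ j + 1) (s (k - (j + 1))))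

/-- The threshold rule with critical numbers `s`, as a vector of `k` choice times. -/
noncomputable def thresholdRule (n : ℕ) (s : ℕ → ℕ) (i k : ℕ) :
    Fin k → Equiv.Perm (Fin n) → ℕ :=
  fun j σ => thresholdTime s i k σ j

/-- Mean period for which the `i`-th object remains a candidate, given that it is one. -/
noncomputable def U₁ (n i : ℕ) : ℝ :=
  ∫ σ, (duration σ i : ℝ) ∂(cond (orderLaw n) {σ | IsCandidate σ i})

/-- Mean period for which the next candidate after time `i` (if any) remains a candidate, given
that the `i`-th object is a candidate. -/
noncomputable def V₁ (n i : ℕ) : ℝ :=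
  ∫ σ, (duration σ (nextCandidate σ i) : ℝ) ∂(cond (orderLaw n) {σ | IsCandidate σ i})

/-- The first time `i ∈ {1, …, n}` at which `g` is nonnegative. -/
noncomputable def firstNonneg (n : ℕ) (g : ℕ → ℝ) : ℕ :=
  sInf {i | 1 ≤ i ∧ i ≤ n ∧ 0 ≤ g i}

/-- The functions `G k`, for `k ≥ 1` (the value at `k = 0` is not used). -/
noncomputable def G (n : ℕ) : ℕ → ℕ → ℝ
  | 0, _ => 0
  | 1, i => (U₁ n i - V₁ n i) / i
  | k + 2, i => (U₁ n i - V₁ n i) / i +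
      ∑ j ∈ Finset.Icc (max (i + 1) (firstNonneg n (G n (k + 1)))) n,
        1 / ((j : ℝ) - 1) * G n (k + 1) j

/-- The critical number `s_k` for `k` choices left. -/
noncomputable def crit (n k : ℕ) : ℕ := firstNonneg n (G n k)

end DurationProblem

/-! The relative ranks of the objects form a code of the order of presentation: the sequence of
relative ranks takes each value in `∏ i, {1, …, i}` exactly once (`rankCode_bijective`). Hence the
object at time `t + 1` is a candidate with probability `1 / (t + 1)`, whatever has been observed
before (`sum_mul_candidate`). With `h i = 1/i + ⋯ + 1/n` (`harmonicTail`) it follows that the mean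
duration of an object selected at time `i` is `i * h i`, and that
`G 1 i = h i - ∑ j > i, h j / (j - 1)`.

*Signs of the functions `G k`.* One has `G 1 i - G 1 (i + 1) = (1 - h (i + 1)) / i`. As `h` is
decreasing and `G 1 n > 0`, the function `G 1` is negative before its first nonnegative value, up to
which it is nondecreasing, and nonnegative from there on. By induction on `k`, each `G k` is
negative before `crit n k` and nonnegative from there on, and `G k ≤ G (k + 1)`, so that the
critical numbers are nonincreasing (`G_nonneg_and_le`).

*The value of the threshold rule.* Let `GPos n k` be the positive part of `G k`. The threshold rule
with `k` choices left, all objects from time `i` on being still to come, has the value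
`W k i = ∑ j ≥ i, GPos n k j` (`thresholdValue`). Downward induction on `i` shows that the
gain `i * h i + W k (i + 1) - W (k + 1) (i + 1)` from selecting a candidate at time `i` is
`i * G (k + 1) i` from the critical number on, and negative before (`selectionGain_le`).

*Optimality.* Let `a` be a function of the ranks observed up to time `i`. For every admissible
vector of choices, the mean of `a` times its payoff telescopes into a quantity which does not depend
on the choices, minus the sum over `t ≥ i` of the means of `a` times the loss caused by the decision
at time `t` (`IsAdmissible.sum_mul_payoff`). The losses are nonnegative for every admissible vector
of choices, and they vanish for the threshold rule. Taking for `a` the indicators of the events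
observable at time `i` gives the inequality of the conditional expectations. -/

namespace DurationProblem

/-! ### The order of presentation and the relative ranks -/

/-- A function of the order of presentation whose value is determined by the relative ranks
observed up to time `t`. -/
def KnownAt {n : ℕ} {α : Type*} (t : ℕ) (f : Equiv.Perm (Fin n) → α) : Prop :=
  ∀ ⦃σ σ'⦄, history n t σ = history n t σ' → f σ = f σ'

section Ranks

variable {n : ℕ}

theorem relRank_eq_card_add_one (σ : Equiv.Perm (Fin n)) (i : Fin n) :
    relRank σ i = (Finset.univ.filter fun j : Fin n => j < i ∧ σ j < σ i).card + 1 := by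
  have : (Finset.univ.filter fun j : Fin n => j ≤ i ∧ σ j ≤ σ i)
      = insert i (Finset.univ.filter fun j : Fin n => j < i ∧ σ j < σ i) := by
    ext j
    simp only [Finset.mem_filter, Finset.mem_univ, true_and, Finset.mem_insert]
    constructor
    · rintro ⟨h1, h2⟩
      rcases eq_or_lt_of_le h1 with h | h
      · exact Or.inl h
      · exact Or.inr ⟨h, lt_of_le_of_ne h2 fun e => h.ne (σ.injective e)⟩
    · rintro (h | ⟨h1, h2⟩)
      · simp [h]
      · exact ⟨h1.le, h2.le⟩
  rw [relRank, this, Finset.card_insert_of_notMem (by simp)]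

theorem relRank_pred_lt (σ : Equiv.Perm (Fin n)) (i : Fin n) : relRank σ i - 1 < (i : ℕ) + 1 := by
  have : (Finset.univ.filter fun j : Fin n => j < i ∧ σ j < σ i).card ≤ (Finset.Iio i).card :=
    Finset.card_le_card fun j hj => by
      simp only [Finset.mem_filter] at hj
      exact Finset.mem_Iio.2 hj.2.1
  rw [Fin.card_Iio] at this
  rw [relRank_eq_card_add_one]
  omega

/-- The sequence of relative ranks, counted from `0` (a form of the Lehmer code). -/
def rankCode (σ : Equiv.Perm (Fin n)) (i : Fin n) : Fin ((i : ℕ) + 1) :=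
  ⟨relRank σ i - 1, relRank_pred_lt σ i⟩

theorem rankCode_eq_iff {σ σ' : Equiv.Perm (Fin n)} {i : Fin n} :
    rankCode σ i = rankCode σ' i ↔ relRank σ i = relRank σ' i := by
  rw [rankCode, rankCode, Fin.mk.injEq, relRank_eq_card_add_one, relRank_eq_card_add_one]
  omega

/-- Relative ranks determine how the object at `i` compares with each of its predecessors: those
which are better form an initial segment, of known size, of the order of the predecessors. -/
theorem lt_iff_lt_of_rankCode_eq {σ σ' : Equiv.Perm (Fin n)} (h : rankCode σ = rankCode σ')
    (i : Fin n) : ∀ j < i, (σ j < σ i ↔ σ' j < σ' i) := by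
  induction i using WellFoundedLT.induction with
  | ind i ih =>
  have pairs : ∀ a < i, ∀ b < i, σ a < σ b → σ' a < σ' b := by
    intro a ha b hb hab
    rcases lt_trichotomy a b with h1 | h1 | h1
    · exact (ih b hb a h1).1 hab
    · exact absurd hab (by simp [h1])
    · by_contra h2
      have h3 : σ' b < σ' a :=
        lt_of_le_of_ne (not_lt.1 h2) fun e => h1.ne (σ'.injective e)
      exact absurd ((ih a ha b h1).2 h3) hab.not_gt
  have hcard : (Finset.univ.filter fun j : Fin n => j < i ∧ σ j < σ i).card
      = (Finset.univ.filter fun j : Fin n => j < i ∧ σ' j < σ' i).card := by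
    have := rankCode_eq_iff.1 (congrFun h i)
    rw [relRank_eq_card_add_one, relRank_eq_card_add_one] at this
    omega
  have hset : (Finset.univ.filter fun j : Fin n => j < i ∧ σ j < σ i)
      = (Finset.univ.filter fun j : Fin n => j < i ∧ σ' j < σ' i) := by
    by_contra hne
    have h1 : ¬ (Finset.univ.filter fun j : Fin n => j < i ∧ σ j < σ i)
        ⊆ (Finset.univ.filter fun j : Fin n => j < i ∧ σ' j < σ' i) := fun hs =>
      hne (Finset.eq_of_subset_of_card_le hs hcard.ge)
    have h2 : ¬ (Finset.univ.filter fun j : Fin n => j < i ∧ σ' j < σ' i)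
        ⊆ (Finset.univ.filter fun j : Fin n => j < i ∧ σ j < σ i) := fun hs =>
      hne (Finset.eq_of_subset_of_card_le hs hcard.le).symm
    obtain ⟨a, ha, ha'⟩ := Finset.not_subset.1 h1
    obtain ⟨b, hb, hb'⟩ := Finset.not_subset.1 h2
    simp only [Finset.mem_filter, Finset.mem_univ, true_and, not_and, not_lt] at ha ha' hb hb'
    exact absurd (pairs a ha.1 b hb.1 (ha.2.trans_le (hb' hb.1)))
      (hb.2.trans_le (ha' ha.1)).not_gt
  intro j hj
  have := Finset.ext_iff.1 hset j
  simpa [hj] using this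

theorem rankCode_injective : Function.Injective (rankCode (n := n)) := by
  intro σ σ' h
  have key : ∀ a b, σ a ≤ σ b ↔ σ' a ≤ σ' b := by
    intro a b
    rcases lt_trichotomy a b with h1 | h1 | h1
    · have := lt_iff_lt_of_rankCode_eq h b a h1
      rw [le_iff_lt_or_eq, le_iff_lt_or_eq, this, σ.injective.eq_iff, σ'.injective.eq_iff]
    · simp [h1]
    · have := lt_iff_lt_of_rankCode_eq h a b h1
      rw [← not_lt, ← not_lt, this]
  let e : Fin n ≃o Fin n :=
    { toEquiv := σ.symm.trans σ'
      map_rel_iff' := by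
        intro a b
        simpa using (key (σ.symm a) (σ.symm b)).symm }
  have he : e = OrderIso.refl (Fin n) := Subsingleton.elim _ _
  ext i
  have h2 : e (σ i) = σ i := by rw [he]; rfl
  have h3 : e (σ i) = σ' i := by simp [e]
  rw [← h3, h2]

theorem rankCode_bijective : Function.Bijective (rankCode (n := n)) := by
  rw [Fintype.bijective_iff_injective_and_card]
  refine ⟨rankCode_injective, ?_⟩
  simp only [Fintype.card_perm, Fintype.card_fin, Fintype.card_pi]
  rw [Fin.prod_univ_eq_prod_range (fun i => i + 1) n, Finset.prod_range_add_one_eq_factorial]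

theorem history_eq_iff {t : ℕ} {σ σ' : Equiv.Perm (Fin n)} :
    history n t σ = history n t σ' ↔
      ∀ i : Fin n, (i : ℕ) + 1 ≤ t → rankCode σ i = rankCode σ' i := by
  constructor
  · intro h i hi
    exact rankCode_eq_iff.2 (congrFun h ⟨i, hi⟩)
  · intro h
    funext i
    exact rankCode_eq_iff.1 (h i.1 i.2)

theorem isCandidate_succ_iff {t : ℕ} (ht : t < n) {σ : Equiv.Perm (Fin n)} :
    IsCandidate σ (t + 1) ↔ rankCode σ ⟨t, ht⟩ = 0 := by
  have h0 : ∀ i : Fin n, relRank σ i = 1 ↔ rankCode σ i = 0 := by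
    intro i
    have := relRank_eq_card_add_one σ i
    rw [Fin.ext_iff]
    change _ ↔ relRank σ i - 1 = 0
    omega
  constructor
  · rintro ⟨i, hi, h⟩
    obtain rfl : i = ⟨t, ht⟩ := Fin.ext (by simpa using hi)
    exact (h0 _).1 h
  · intro h
    exact ⟨⟨t, ht⟩, rfl, (h0 _).2 h⟩

theorem IsCandidate.le {t : ℕ} {σ : Equiv.Perm (Fin n)} (h : IsCandidate σ t) : t ≤ n := by
  obtain ⟨i, hi, -⟩ := h
  omega

theorem knownAt_isCandidate {s t : ℕ} (hst : s ≤ t) :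
    KnownAt t fun σ : Equiv.Perm (Fin n) => IsCandidate σ s := by
  intro σ σ' h
  refine propext (exists_congr fun i => and_congr_right fun hi => ?_)
  have : relRank σ i = relRank σ' i := congrFun h ⟨i, by omega⟩
  rw [this]

theorem history_eq_mono {s t : ℕ} (hst : s ≤ t) {σ σ' : Equiv.Perm (Fin n)}
    (h : history n t σ = history n t σ') : history n s σ = history n s σ' := by
  funext i
  exact congrFun h ⟨i.1, i.2.trans hst⟩

theorem KnownAt.mono {α : Type*} {s t : ℕ} (hst : s ≤ t) {f : Equiv.Perm (Fin n) → α}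
    (hf : KnownAt s f) : KnownAt t f := fun _ _ h => hf (history_eq_mono hst h)

open scoped Classical in
/-- The indicator of a proposition. -/
noncomputable def ind (p : Prop) : ℝ := if p then 1 else 0

theorem ind_true {p : Prop} (h : p) : ind p = 1 := if_pos h

theorem ind_false {p : Prop} (h : ¬ p) : ind p = 0 := if_neg h

theorem ind_nonneg (p : Prop) : 0 ≤ ind p := by
  by_cases h : p
  · simp [ind_true h]
  · simp [ind_false h]

/-- Independence of the relative ranks, in the form used throughout: whatever has been observed up
to time `t`, the object at time `t + 1` is a candidate with probability `1 / (t + 1)`. Changing the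
relative rank at time `t + 1` does not affect the other ranks, so that all its values are equally
likely. -/
theorem sum_mul_candidate {t : ℕ} (ht : t < n) {f : Equiv.Perm (Fin n) → ℝ} (hf : KnownAt t f) :
    ∑ σ, f σ * ind (IsCandidate σ (t + 1)) = (∑ σ, f σ) / ((t : ℝ) + 1) := by
  set c : Fin n := ⟨t, ht⟩ with hc
  let e := Equiv.ofBijective (rankCode (n := n)) rankCode_bijective
  have he : ∀ x, rankCode (e.symm x) = x := fun x => e.apply_symm_apply x
  have hr : ∀ r : Fin ((c : ℕ) + 1), ∑ σ, f σ * ind (rankCode σ c = r)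
      = ∑ σ, f σ * ind (rankCode σ c = 0) := by
    intro r
    let φ : (∀ i : Fin n, Fin ((i : ℕ) + 1)) → (∀ i : Fin n, Fin ((i : ℕ) + 1)) :=
      fun x => Function.update x c (Equiv.swap 0 r (x c))
    have hφ : Function.Involutive φ := by
      intro x
      simp [φ]
    refine Fintype.sum_equiv ((e.trans hφ.toPerm).trans e.symm) _ _ fun σ => ?_
    have h1 : rankCode (((e.trans hφ.toPerm).trans e.symm) σ) = φ (rankCode σ) := he _
    have h2 : f (((e.trans hφ.toPerm).trans e.symm) σ) = f σ := by
      refine hf (history_eq_iff.2 fun i hi => ?_)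
      rw [h1]
      refine Function.update_of_ne ?_ _ _
      rintro rfl
      simp [hc] at hi
    rw [h1, h2]
    have h3 : (φ (rankCode σ) c = 0) = (rankCode σ c = r) := by
      simp only [φ, Function.update_self, eq_iff_iff]
      rw [Equiv.swap_apply_eq_iff, Equiv.swap_apply_left]
    rw [h3]
  have hsum : ∑ σ, f σ = ∑ r : Fin ((c : ℕ) + 1), ∑ σ, f σ * ind (rankCode σ c = r) := by
    rw [Finset.sum_comm]
    refine Finset.sum_congr rfl fun σ _ => ?_
    rw [← Finset.mul_sum]
    rw [Finset.sum_eq_single (rankCode σ c) (fun r _ hne => ind_false hne.symm) (by simp),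
      ind_true rfl, mul_one]
  have h1 : ∀ σ : Equiv.Perm (Fin n), IsCandidate σ (t + 1) = (rankCode σ c = 0) := fun σ =>
    propext (isCandidate_succ_iff ht)
  have h2 : ((t : ℝ) + 1) ≠ 0 := by positivity
  simp_rw [h1]
  rw [hsum, Finset.sum_congr rfl fun r _ => hr r, eq_div_iff h2]
  simp [hc, mul_comm]

end Ranks
/-! ### Times and durations of candidates -/

section Times

variable {n : ℕ}

theorem firstCandidateFrom_spec (σ : Equiv.Perm (Fin n)) (a : ℕ) :
    (a ≤ firstCandidateFrom σ a ∧ IsCandidate σ (firstCandidateFrom σ a)) ∨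
      firstCandidateFrom σ a = n + 1 :=
  Nat.sInf_mem (s := {t | (a ≤ t ∧ IsCandidate σ t) ∨ t = n + 1}) ⟨n + 1, Or.inr rfl⟩

theorem firstCandidateFrom_le (σ : Equiv.Perm (Fin n)) (a : ℕ) :
    firstCandidateFrom σ a ≤ n + 1 :=
  Nat.sInf_le (Or.inr rfl)

theorem firstCandidateFrom_le_of_isCandidate {σ : Equiv.Perm (Fin n)} {a t : ℕ} (hat : a ≤ t)
    (h : IsCandidate σ t) : firstCandidateFrom σ a ≤ t :=
  Nat.sInf_le (Or.inl ⟨hat, h⟩)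

theorem lt_firstCandidateFrom_iff {σ : Equiv.Perm (Fin n)} {a t : ℕ} (ht : t ≤ n) :
    t < firstCandidateFrom σ a ↔ ∀ s, a ≤ s → s ≤ t → ¬ IsCandidate σ s := by
  constructor
  · intro h s h1 h2 hc
    exact absurd (firstCandidateFrom_le_of_isCandidate h1 hc) (by omega)
  · intro h
    rcases firstCandidateFrom_spec σ a with h1 | h1
    · by_contra h2
      exact h _ h1.1 (not_lt.1 h2) h1.2
    · omega

theorem lt_nextCandidate {σ : Equiv.Perm (Fin n)} {i : ℕ} (hi : i ≤ n) : i < nextCandidate σ i := by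
  rcases firstCandidateFrom_spec σ (i + 1) with h | h
  · exact h.1
  · rw [nextCandidate]
    omega

theorem nextCandidate_le (σ : Equiv.Perm (Fin n)) (i : ℕ) : nextCandidate σ i ≤ n + 1 :=
  firstCandidateFrom_le σ _

theorem knownAt_lt_nextCandidate {i t : ℕ} (ht : t ≤ n) :
    KnownAt t fun σ : Equiv.Perm (Fin n) => t < nextCandidate σ i := by
  intro σ σ' h
  have key : ∀ s ≤ t, IsCandidate σ s = IsCandidate σ' s := fun s hs =>
    knownAt_isCandidate hs h
  refine propext ?_
  simp only [nextCandidate]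
  rw [lt_firstCandidateFrom_iff ht, lt_firstCandidateFrom_iff ht]
  exact forall_congr' fun s => forall_congr' fun _ => forall_congr' fun hs => by rw [key s hs]

theorem succ_lt_nextCandidate_iff {σ : Equiv.Perm (Fin n)} {i t : ℕ} (hit : i ≤ t) (ht : t < n) :
    t + 1 < nextCandidate σ i ↔ t < nextCandidate σ i ∧ ¬ IsCandidate σ (t + 1) := by
  rw [nextCandidate, lt_firstCandidateFrom_iff ht, lt_firstCandidateFrom_iff ht.le]
  constructor
  · intro h
    exact ⟨fun s h1 h2 => h s h1 (by omega), h _ (by omega) le_rfl⟩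
  · rintro ⟨h, h'⟩ s h1 h2
    rcases Nat.lt_or_eq_of_le h2 with h3 | rfl
    · exact h s h1 (by omega)
    · exact h'

theorem ind_and (p q : Prop) : ind (p ∧ q) = ind p * ind q := by
  by_cases hp : p <;> by_cases hq : q <;> simp [ind, hp, hq]

theorem ind_not (p : Prop) : ind (¬ p) = 1 - ind p := by
  by_cases hp : p <;> simp [ind, hp]

theorem ind_succ_lt_nextCandidate {σ : Equiv.Perm (Fin n)} {i t : ℕ} (hit : i ≤ t) (ht : t < n) :
    ind (t + 1 < nextCandidate σ i)
      = ind (t < nextCandidate σ i) - ind (t < nextCandidate σ i) * ind (IsCandidate σ (t + 1)) := by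
  rw [propext (succ_lt_nextCandidate_iff hit ht), ind_and, ind_not]
  ring

theorem ind_nextCandidate_eq_succ {σ : Equiv.Perm (Fin n)} {i t : ℕ} (hit : i ≤ t) (ht : t < n) :
    ind (nextCandidate σ i = t + 1)
      = ind (t < nextCandidate σ i) * ind (IsCandidate σ (t + 1)) := by
  rw [← ind_and]
  congr 1
  have h := succ_lt_nextCandidate_iff (σ := σ) hit ht
  refine propext ⟨fun h1 => ?_, fun h1 => ?_⟩
  · have h2 : t < nextCandidate σ i := by omega
    exact ⟨h2, by_contra fun h3 => absurd (h.2 ⟨h2, h3⟩) (by omega)⟩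
  · have h2 : ¬ t + 1 < nextCandidate σ i := fun h3 => (h.1 h3).2 h1.2
    omega

/-- The tail `1/i + ⋯ + 1/n` of the harmonic sum. -/
noncomputable def harmonicTail (n i : ℕ) : ℝ := ∑ t ∈ Finset.Icc i n, 1 / (t : ℝ)

theorem sum_Icc_eq_add {M : Type*} [AddCommMonoid M] {a b : ℕ} (h : a ≤ b) (f : ℕ → M) :
    ∑ t ∈ Finset.Icc a b, f t = f a + ∑ t ∈ Finset.Icc (a + 1) b, f t := by
  rw [← Finset.insert_Icc_add_one_left_eq_Icc h, Finset.sum_insert (by simp)]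

/-- The probability that no candidate appears in `(i, t]` is `i / t`, whatever has been observed up
to time `i`. -/
theorem sum_mul_lt_nextCandidate {i t : ℕ} (hi : 1 ≤ i) (hit : i ≤ t) (ht : t ≤ n)
    {f : Equiv.Perm (Fin n) → ℝ} (hf : KnownAt i f) :
    ∑ σ, f σ * ind (t < nextCandidate σ i) = (i : ℝ) / t * ∑ σ, f σ := by
  induction t, hit using Nat.le_induction with
  | base =>
    rw [div_self (by positivity), one_mul]
    exact Finset.sum_congr rfl fun σ _ => by rw [ind_true (lt_nextCandidate ht), mul_one]
  | succ t hit ih =>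
    have ih := ih (by omega)
    have hk : KnownAt t fun σ : Equiv.Perm (Fin n) => f σ * ind (t < nextCandidate σ i) := by
      intro σ σ' h
      have h1 := hf.mono hit h
      have h2 := knownAt_lt_nextCandidate (i := i) (by omega : t ≤ n) h
      simp only at h2 ⊢
      rw [h1, h2]
    have h1 := sum_mul_candidate (by omega : t < n) hk
    have h2 : ∀ σ : Equiv.Perm (Fin n), f σ * ind (t + 1 < nextCandidate σ i)
        = f σ * ind (t < nextCandidate σ i)
          - f σ * ind (t < nextCandidate σ i) * ind (IsCandidate σ (t + 1)) := fun σ => by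
      rw [ind_succ_lt_nextCandidate hit (by omega)]
      ring
    rw [Finset.sum_congr rfl fun σ _ => h2 σ, Finset.sum_sub_distrib, h1, ih]
    have : (0 : ℝ) < t := by
      have : 0 < t := by omega
      exact_mod_cast this
    push_cast
    field_simp
    ring

theorem duration_eq_sum (σ : Equiv.Perm (Fin n)) {i : ℕ} (hi : i ≤ n) :
    (duration σ i : ℝ) = ∑ t ∈ Finset.Icc i n, ind (t < nextCandidate σ i) := by
  have h1 := lt_nextCandidate (σ := σ) hi
  have h2 := nextCandidate_le σ i
  have h3 : ∑ t ∈ Finset.Ico i (nextCandidate σ i), ind (t < nextCandidate σ i)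
      = ∑ t ∈ Finset.Icc i n, ind (t < nextCandidate σ i) := by
    refine Finset.sum_subset (fun t ht => ?_) fun t ht ht' => ind_false fun h => ht' ?_
    · rw [Finset.mem_Ico] at ht
      rw [Finset.mem_Icc]
      omega
    · rw [Finset.mem_Icc] at ht
      exact Finset.mem_Ico.2 ⟨ht.1, h⟩
  rw [← h3, Finset.sum_congr rfl fun t ht => ind_true (Finset.mem_Ico.1 ht).2]
  simp [duration]

theorem duration_succ_self (σ : Equiv.Perm (Fin n)) : duration σ (n + 1) = 0 := by
  have := nextCandidate_le σ (n + 1)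
  rw [duration]
  omega

/-- The mean duration of an object selected at time `i` is `i (1/i + ⋯ + 1/n)`, whatever has been
observed up to time `i`. -/
theorem sum_mul_duration {i : ℕ} (hi : 1 ≤ i) (hin : i ≤ n)
    {f : Equiv.Perm (Fin n) → ℝ} (hf : KnownAt i f) :
    ∑ σ, f σ * duration σ i = i * harmonicTail n i * ∑ σ, f σ := by
  have : ∀ σ, f σ * duration σ i = ∑ t ∈ Finset.Icc i n, f σ * ind (t < nextCandidate σ i) :=
    fun σ => by rw [duration_eq_sum σ hin, Finset.mul_sum]
  rw [Finset.sum_congr rfl fun σ _ => this σ, Finset.sum_comm, mul_right_comm, harmonicTail,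
    Finset.mul_sum]
  refine Finset.sum_congr rfl fun t ht => ?_
  rw [Finset.mem_Icc] at ht
  rw [sum_mul_lt_nextCandidate hi ht.1 ht.2 hf]
  ring

theorem sum_mul_duration_nextCandidate {i : ℕ} (hi : 1 ≤ i) (hin : i ≤ n)
    {f : Equiv.Perm (Fin n) → ℝ} (hf : KnownAt i f) :
    ∑ σ, f σ * duration σ (nextCandidate σ i)
      = i * (∑ j ∈ Finset.Icc (i + 1) n, harmonicTail n j / ((j : ℝ) - 1)) * ∑ σ, f σ := by
  have : ∀ σ, f σ * duration σ (nextCandidate σ i)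
      = ∑ j ∈ Finset.Icc (i + 1) n, f σ * ind (nextCandidate σ i = j) * duration σ j := by
    intro σ
    have h1 := lt_nextCandidate (σ := σ) hin
    have h2 := nextCandidate_le σ i
    rcases Nat.lt_or_eq_of_le h2 with h3 | h3
    · rw [Finset.sum_eq_single (nextCandidate σ i), ind_true rfl, mul_one]
      · intro j _ hj
        rw [ind_false hj.symm]
        ring
      · intro h4
        exact absurd (Finset.mem_Icc.2 ⟨h1, by omega⟩) h4
    · rw [h3, duration_succ_self, Finset.sum_eq_zero]
      · simp
      · intro j hj
        rw [Finset.mem_Icc] at hj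
        rw [ind_false (by omega)]
        ring
  rw [Finset.sum_congr rfl fun σ _ => this σ, Finset.sum_comm, mul_right_comm, Finset.mul_sum]
  refine Finset.sum_congr rfl fun j hj => ?_
  rw [Finset.mem_Icc] at hj
  obtain ⟨t, rfl⟩ : ∃ t, j = t + 1 := ⟨j - 1, by omega⟩
  have hit : i ≤ t := by omega
  have htn : t < n := by omega
  have hk : KnownAt t fun σ : Equiv.Perm (Fin n) => f σ * ind (t < nextCandidate σ i) := by
    intro σ σ' h
    have h1 := hf.mono hit h
    have h2 := knownAt_lt_nextCandidate (i := i) htn.le h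
    simp only at h2 ⊢
    rw [h1, h2]
  have he : ∀ σ : Equiv.Perm (Fin n), f σ * ind (nextCandidate σ i = t + 1)
      = f σ * ind (t < nextCandidate σ i) * ind (IsCandidate σ (t + 1)) := fun σ => by
    rw [ind_nextCandidate_eq_succ hit htn, mul_assoc]
  have hk' : KnownAt (t + 1) fun σ : Equiv.Perm (Fin n) =>
      f σ * ind (nextCandidate σ i = t + 1) := by
    intro σ σ' h
    have h1 := hk.mono (Nat.le_succ t) h
    have h2 := knownAt_isCandidate (le_refl (t + 1)) h
    simp only at h1 h2
    simp only [he, h1, h2]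
  rw [sum_mul_duration (by omega) hj.2 hk', Finset.sum_congr rfl fun σ _ => he σ,
    sum_mul_candidate htn hk, sum_mul_lt_nextCandidate hi hit htn.le hf]
  have : (0 : ℝ) < t := by
    have : 0 < t := by omega
    exact_mod_cast this
  push_cast
  rw [add_sub_cancel_right]
  field_simp

/-! ### Integrals with respect to the law of the order -/

theorem integral_orderLaw (f : Equiv.Perm (Fin n) → ℝ) :
    ∫ σ, f σ ∂(orderLaw n) = (Nat.factorial n : ℝ)⁻¹ * ∑ σ, f σ := by
  rw [orderLaw, uniformOn, ProbabilityTheory.cond, integral_smul_measure, Measure.restrict_univ, integral_count,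
    Measure.count_univ]
  simp [Fintype.card_perm]

instance instIsProbabilityMeasureOrderLaw : IsProbabilityMeasure (orderLaw n) :=
  isProbabilityMeasure_uniformOn Set.finite_univ Set.univ_nonempty

theorem setIntegral_orderLaw (A : Set (Equiv.Perm (Fin n))) (f : Equiv.Perm (Fin n) → ℝ) :
    ∫ σ in A, f σ ∂(orderLaw n) = (Nat.factorial n : ℝ)⁻¹ * ∑ σ, ind (σ ∈ A) * f σ := by
  rw [← integral_indicator MeasurableSpace.measurableSet_top, integral_orderLaw]
  congr 1
  refine Finset.sum_congr rfl fun σ _ => ?_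
  by_cases h : σ ∈ A
  · rw [Set.indicator_of_mem h, ind_true h, one_mul]
  · rw [Set.indicator_of_notMem h, ind_false h, zero_mul]

theorem sum_ind_isCandidate_pos {i : ℕ} (hi : 1 ≤ i) (hin : i ≤ n) :
    0 < ∑ σ : Equiv.Perm (Fin n), ind (IsCandidate σ i) := by
  obtain ⟨t, rfl⟩ : ∃ t, i = t + 1 := ⟨i - 1, by omega⟩
  have := sum_mul_candidate (n := n) (t := t) hin (f := fun _ => 1) fun _ _ _ => rfl
  simp only [one_mul] at this
  rw [this]
  simp only [Finset.sum_const, Finset.card_univ, nsmul_eq_mul, mul_one]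
  have : 0 < Fintype.card (Equiv.Perm (Fin n)) := Fintype.card_pos
  positivity

/-- If a function has mean `c` given anything observed up to time `i`, then it has mean `c` given
that the object at time `i` is a candidate. -/
theorem integral_cond_isCandidate {i : ℕ} (hi : 1 ≤ i) (hin : i ≤ n)
    {X : Equiv.Perm (Fin n) → ℝ} {c : ℝ}
    (hX : ∀ f : Equiv.Perm (Fin n) → ℝ, KnownAt i f → ∑ σ, f σ * X σ = c * ∑ σ, f σ) :
    ∫ σ, X σ ∂(cond (orderLaw n) {σ | IsCandidate σ i}) = c := by
  have hpos := sum_ind_isCandidate_pos hi hin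
  have hm : (orderLaw n).real {σ | IsCandidate σ i}
      = (Nat.factorial n : ℝ)⁻¹ * ∑ σ : Equiv.Perm (Fin n), ind (IsCandidate σ i) := by
    have := setIntegral_orderLaw {σ : Equiv.Perm (Fin n) | IsCandidate σ i} fun _ => 1
    rw [setIntegral_const] at this
    simpa using this
  have hk : KnownAt i fun σ : Equiv.Perm (Fin n) => ind (IsCandidate σ i) := by
    intro σ σ' h
    exact congrArg ind (knownAt_isCandidate le_rfl h)
  rw [ProbabilityTheory.cond, integral_smul_measure, setIntegral_orderLaw, ENNReal.toReal_inv,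
    ← measureReal_def, hm, smul_eq_mul]
  simp only [Set.mem_ofPred_eq]
  rw [hX _ hk]
  have : (0 : ℝ) < Nat.factorial n := by positivity
  field_simp

theorem U₁_eq {i : ℕ} (hi : 1 ≤ i) (hin : i ≤ n) : U₁ n i = i * harmonicTail n i :=
  integral_cond_isCandidate hi hin fun _ hf => sum_mul_duration hi hin hf

theorem V₁_eq {i : ℕ} (hi : 1 ≤ i) (hin : i ≤ n) :
    V₁ n i = i * ∑ j ∈ Finset.Icc (i + 1) n, harmonicTail n j / ((j : ℝ) - 1) :=
  integral_cond_isCandidate hi hin fun _ hf => sum_mul_duration_nextCandidate hi hin hf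

end Times
/-! ### The functions `G k` and the critical numbers -/

section Critical

variable {n : ℕ}

/-- The part of `G k` from the critical number on; there is none when no choice is left. As `G k`
is negative before the critical number and nonnegative from there on, this is its positive part. -/
noncomputable def GPos (n k i : ℕ) : ℝ :=
  if k ≠ 0 ∧ crit n k ≤ i then G n k i else 0

theorem harmonicTail_eq_add {i : ℕ} (hin : i ≤ n) :
    harmonicTail n i = 1 / i + harmonicTail n (i + 1) :=
  sum_Icc_eq_add hin _

theorem harmonicTail_anti {i j : ℕ} (hij : i ≤ j) : harmonicTail n j ≤ harmonicTail n i :=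
  Finset.sum_le_sum_of_subset_of_nonneg (Finset.Icc_subset_Icc_left hij) fun _ _ _ => by positivity

theorem harmonicTail_of_lt {i : ℕ} (h : n < i) : harmonicTail n i = 0 := by
  simp [harmonicTail, Finset.Icc_eq_empty_of_lt h]

theorem G_one_eq {i : ℕ} (hi : 1 ≤ i) (hin : i ≤ n) :
    G n 1 i = harmonicTail n i
      - ∑ j ∈ Finset.Icc (i + 1) n, harmonicTail n j / ((j : ℝ) - 1) := by
  have : (0 : ℝ) < i := by exact_mod_cast hi
  rw [G, U₁_eq hi hin, V₁_eq hi hin]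
  field_simp

theorem G_succ_eq (k i : ℕ) :
    G n (k + 1) i = G n 1 i + ∑ j ∈ Finset.Icc (i + 1) n, GPos n k j / ((j : ℝ) - 1) := by
  cases k with
  | zero => simp [GPos]
  | succ k =>
    have h : Finset.Icc (max (i + 1) (crit n (k + 1))) n
        = (Finset.Icc (i + 1) n).filter fun j => crit n (k + 1) ≤ j := by
      ext j
      simp only [Finset.mem_Icc, Finset.mem_filter, max_le_iff]
      tauto
    rw [G, G]
    change _ + ∑ j ∈ Finset.Icc (max (i + 1) (crit n (k + 1))) n, _ = _
    rw [h, Finset.sum_filter]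
    congr 1
    refine Finset.sum_congr rfl fun j _ => ?_
    simp only [GPos, ne_eq, Nat.succ_ne_zero, not_false_eq_true, true_and]
    split_ifs
    · ring
    · simp

theorem G_succ_self (hn : 1 ≤ n) (k : ℕ) : G n (k + 1) n = 1 / n := by
  rw [G_succ_eq, G_one_eq hn le_rfl, harmonicTail_eq_add le_rfl]
  simp [harmonicTail_of_lt]

theorem G_one_step {i : ℕ} (hi : 1 ≤ i) (hin : i < n) :
    G n 1 i = G n 1 (i + 1) + (1 - harmonicTail n (i + 1)) / i := by
  have : (0 : ℝ) < i := by exact_mod_cast hi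
  rw [G_one_eq hi hin.le, G_one_eq (by omega) hin, harmonicTail_eq_add hin.le,
    sum_Icc_eq_add (by omega : i + 1 ≤ n)]
  push_cast
  rw [add_sub_cancel_right]
  field_simp
  ring

theorem G_succ_step {k i : ℕ} (hi : 1 ≤ i) (hin : i < n) :
    G n (k + 1) i
      = G n (k + 1) (i + 1) + (1 - harmonicTail n (i + 1) + GPos n k (i + 1)) / i := by
  rw [G_succ_eq k i, G_succ_eq k (i + 1), G_one_step hi hin,
    sum_Icc_eq_add (by omega : i + 1 ≤ n)]
  push_cast
  rw [add_sub_cancel_right]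
  ring

/-- The set defining the critical number is not empty: it contains `n`. -/
theorem isLeast_crit (hn : 1 ≤ n) (k : ℕ) :
    IsLeast {i | 1 ≤ i ∧ i ≤ n ∧ 0 ≤ G n (k + 1) i} (crit n (k + 1)) :=
  have hne : {i | 1 ≤ i ∧ i ≤ n ∧ 0 ≤ G n (k + 1) i}.Nonempty :=
    ⟨n, hn, le_rfl, by rw [G_succ_self hn]; positivity⟩
  ⟨Nat.sInf_mem hne, fun _ h => Nat.sInf_le h⟩

theorem G_neg_of_lt_crit (hn : 1 ≤ n) {k i : ℕ} (hi : 1 ≤ i) (h : i < crit n (k + 1)) :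
    G n (k + 1) i < 0 := by
  by_contra h1
  have h2 := (isLeast_crit hn k).1.2.1
  exact absurd ((isLeast_crit hn k).2 ⟨hi, by omega, not_lt.1 h1⟩) (by omega)

/-- As long as the tail of the harmonic sum is less than `1`, `G 1` does not decrease when one
goes backwards in time from `G 1 n = 1 / n`. -/
theorem G_one_pos_of_harmonicTail_lt (hn : 1 ≤ n) {i : ℕ} (hi : 1 ≤ i) (hin : i ≤ n)
    (h : harmonicTail n (i + 1) < 1) : 0 < G n 1 i := by
  induction hin using Nat.decreasingInduction with
  | self =>
    rw [G_succ_self hn 0]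
    positivity
  | of_succ i hin ih =>
    have h1 := ih (by omega) ((harmonicTail_anti (Nat.le_succ _)).trans_lt h)
    rw [G_one_step hi hin]
    have : 0 ≤ (1 - harmonicTail n (i + 1)) / i := div_nonneg (by linarith) (by positivity)
    linarith

theorem G_one_le_succ (hn : 1 ≤ n) {i : ℕ} (hi : 1 ≤ i) (h : i < crit n 1) :
    G n 1 i ≤ G n 1 (i + 1) := by
  have h2 : crit n 1 ≤ n := (isLeast_crit hn 0).1.2.1
  have h1 : 1 ≤ harmonicTail n (i + 1) := by
    by_contra h1
    have := G_one_pos_of_harmonicTail_lt hn hi (by omega) (not_le.1 h1)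
    linarith [G_neg_of_lt_crit (k := 0) hn hi h]
  rw [G_one_step hi (by omega)]
  have : (1 - harmonicTail n (i + 1)) / i ≤ 0 :=
    div_nonpos_of_nonpos_of_nonneg (by linarith) (by positivity)
  linarith

theorem G_one_nonneg_of_crit_le (hn : 1 ≤ n) {i : ℕ} (h : crit n 1 ≤ i) (hin : i ≤ n) :
    0 ≤ G n 1 i := by
  have hc : 1 ≤ crit n 1 ∧ crit n 1 ≤ n ∧ 0 ≤ G n 1 (crit n 1) := (isLeast_crit hn 0).1
  induction i, h using Nat.le_induction with
  | base => exact hc.2.2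
  | succ i hi ih =>
    have ih := ih (by omega)
    rcases lt_or_ge (harmonicTail n (i + 1)) 1 with h1 | h1
    · exact (G_one_pos_of_harmonicTail_lt hn (by omega) hin
        ((harmonicTail_anti (Nat.le_succ _)).trans_lt h1)).le
    · rw [G_one_step (by omega) (by omega)] at ih
      have : (1 - harmonicTail n (i + 1)) / i ≤ 0 :=
        div_nonpos_of_nonpos_of_nonneg (by linarith) (by positivity)
      linarith

theorem G_one_le_of_le_crit (hn : 1 ≤ n) {i j : ℕ} (hi : 1 ≤ i) (hij : i ≤ j) (h : j ≤ crit n 1) :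
    G n 1 i ≤ G n 1 j := by
  induction j, hij using Nat.le_induction with
  | base => exact le_rfl
  | succ j hj ih => exact (ih (by omega)).trans (G_one_le_succ hn (by omega) (by omega))

theorem GPos_of_crit_le {k i : ℕ} (h : crit n (k + 1) ≤ i) : GPos n (k + 1) i = G n (k + 1) i :=
  if_pos ⟨Nat.succ_ne_zero k, h⟩

theorem GPos_of_lt_crit {k i : ℕ} (h : i < crit n (k + 1)) : GPos n (k + 1) i = 0 :=
  if_neg fun h1 => absurd h1.2 (by omega)

theorem GPos_zero (i : ℕ) : GPos n 0 i = 0 := if_neg fun h => h.1 rfl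

theorem crit_le_of_G_le (hn : 1 ≤ n) {k l : ℕ}
    (h : ∀ i, 1 ≤ i → i ≤ n → G n (k + 1) i ≤ G n (l + 1) i) : crit n (l + 1) ≤ crit n (k + 1) := by
  have h1 := (isLeast_crit hn k).1
  exact (isLeast_crit hn l).2 ⟨h1.1, h1.2.1, h1.2.2.trans (h _ h1.1 h1.2.1)⟩

/-- By induction on `k`: `G k` keeps its sign from the critical number on, and `G k ≤ G (k + 1)`.
The latter makes the critical numbers nonincreasing. Before the critical number of
`k` choices, `G (k + 1)` differs from `G 1` by a constant only and is thus nondecreasing. -/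
theorem G_nonneg_and_le (hn : 1 ≤ n) (k : ℕ) :
    (∀ i, crit n (k + 1) ≤ i → i ≤ n → 0 ≤ G n (k + 1) i) ∧
      (∀ i, 1 ≤ i → i ≤ n → G n (k + 1) i ≤ G n (k + 2) i) ∧ crit n (k + 1) ≤ crit n 1 := by
  induction k with
  | zero =>
    refine ⟨fun i h hin => G_one_nonneg_of_crit_le hn h hin, fun i hi hin => ?_, le_rfl⟩
    rw [G_succ_eq 1 i]
    refine le_add_of_nonneg_right (Finset.sum_nonneg fun j hj => ?_)
    rw [Finset.mem_Icc] at hj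
    have hj1 : (1 : ℝ) ≤ j := by
      have : 1 ≤ j := by omega
      exact_mod_cast this
    refine div_nonneg ?_ (by linarith)
    rcases le_or_gt (crit n 1) j with h | h
    · rw [GPos_of_crit_le h]
      exact G_one_nonneg_of_crit_le hn h hj.2
    · rw [GPos_of_lt_crit h]
  | succ k ih =>
    obtain ⟨ih1, ih2, ih3⟩ := ih
    have hcrit : crit n (k + 2) ≤ crit n (k + 1) := crit_le_of_G_le hn ih2
    have hc := (isLeast_crit hn (k + 1)).1
    have hc1 := (isLeast_crit hn k).1
    have h1 : ∀ i, crit n (k + 2) ≤ i → i ≤ n → 0 ≤ G n (k + 2) i := by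
      intro i hi hin
      rcases le_or_gt (crit n (k + 1)) i with h | h
      · exact (ih1 i h hin).trans (ih2 i (hc1.1.trans h) hin)
      · refine hc.2.2.trans ?_
        have hconst : ∀ a, 1 ≤ a → a < crit n (k + 1) → G n (k + 2) a = G n 1 a
            + ∑ j ∈ Finset.Icc (crit n (k + 1)) n, GPos n (k + 1) j / ((j : ℝ) - 1) := by
          intro a ha hac
          rw [G_succ_eq]
          congr 1
          symm
          refine Finset.sum_subset (Finset.Icc_subset_Icc_left (by omega)) fun j hj hj' => ?_
          rw [Finset.mem_Icc] at hj hj'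
          rw [GPos_of_lt_crit (by omega), zero_div]
        rw [hconst _ hc.1 (hi.trans_lt h), hconst _ (hc.1.trans hi) h]
        have := G_one_le_of_le_crit hn hc.1 hi (by omega)
        linarith
    refine ⟨h1, fun i hi hin => ?_, hcrit.trans ih3⟩
    rw [G_succ_eq (k + 1) i, G_succ_eq (k + 2) i]
    refine add_le_add_right (Finset.sum_le_sum fun j hj => ?_) _
    rw [Finset.mem_Icc] at hj
    have hj1 : (1 : ℝ) ≤ j := by
      have : 1 ≤ j := by omega
      exact_mod_cast this
    refine div_le_div_of_nonneg_right ?_ (by linarith)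
    rcases le_or_gt (crit n (k + 1)) j with h | h
    · rw [GPos_of_crit_le h, GPos_of_crit_le (hcrit.trans h)]
      exact ih2 j (by omega) hj.2
    · rw [GPos_of_lt_crit h]
      rcases le_or_gt (crit n (k + 2)) j with h2 | h2
      · rw [GPos_of_crit_le h2]
        exact h1 j h2 hj.2
      · rw [GPos_of_lt_crit h2]

theorem crit_succ_le (hn : 1 ≤ n) (k : ℕ) : crit n (k + 2) ≤ crit n (k + 1) :=
  crit_le_of_G_le hn (G_nonneg_and_le hn k).2.1

theorem GPos_nonneg (hn : 1 ≤ n) {k i : ℕ} (hin : i ≤ n) : 0 ≤ GPos n k i := by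
  cases k with
  | zero => rw [GPos_zero]
  | succ k =>
    rcases le_or_gt (crit n (k + 1)) i with h | h
    · rw [GPos_of_crit_le h]
      exact (G_nonneg_and_le hn k).1 i h hin
    · rw [GPos_of_lt_crit h]

/-- The mean total duration under the threshold rule when `k` choices are left and the objects from
time `i` on are still to come: since a candidate appears at time `j` with probability `1 / j`, and
the threshold rule gains `j * GPos n k j` by selecting it, each time `j` contributes
`GPos n k j`. -/
noncomputable def thresholdValue (n k i : ℕ) : ℝ := ∑ j ∈ Finset.Icc i n, GPos n k j

theorem thresholdValue_eq_add {k i : ℕ} (hin : i ≤ n) :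
    thresholdValue n k i = GPos n k i + thresholdValue n k (i + 1) :=
  sum_Icc_eq_add hin _

theorem thresholdValue_of_lt {k i : ℕ} (h : n < i) : thresholdValue n k i = 0 := by
  simp [thresholdValue, Finset.Icc_eq_empty_of_lt h]

/-- The gain from selecting a candidate at time `i` rather than passing it over, when `k + 1`
choices are left and the threshold rule is followed afterwards. -/
noncomputable def selectionGain (n k i : ℕ) : ℝ :=
  i * harmonicTail n i + thresholdValue n k (i + 1) - thresholdValue n (k + 1) (i + 1)

/-- `i * G (k + 1) i` compares selecting at time `i` with selecting the next candidate. This is the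
gain from selecting if the next candidate is to be selected anyway, and an upper bound for
the gain otherwise. -/
theorem selectionGain_le (hn : 1 ≤ n) {k i : ℕ} (hi : 1 ≤ i) (hin : i ≤ n) :
    selectionGain n k i ≤ i * G n (k + 1) i ∧
      (crit n (k + 1) ≤ i → selectionGain n k i = i * G n (k + 1) i) := by
  induction hin using Nat.decreasingInduction with
  | self =>
    have : (0 : ℝ) < n := by exact_mod_cast hn
    have h : selectionGain n k n = n * G n (k + 1) n := by
      rw [selectionGain, G_succ_self hn, harmonicTail_eq_add le_rfl,
        harmonicTail_of_lt (Nat.lt_succ_self n), thresholdValue_of_lt (Nat.lt_succ_self n),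
        thresholdValue_of_lt (Nat.lt_succ_self n)]
      ring
    exact ⟨h.le, fun _ => h⟩
  | of_succ i hin ih =>
    obtain ⟨ih1, ih2⟩ := ih (by omega)
    have hi0 : (0 : ℝ) < i := by exact_mod_cast hi
    have key : selectionGain n k i - i * G n (k + 1) i
        = selectionGain n k (i + 1) - (i + 1 : ℕ) * G n (k + 1) (i + 1)
          + (G n (k + 1) (i + 1) - GPos n (k + 1) (i + 1)) := by
      rw [selectionGain, selectionGain, G_succ_step hi hin, harmonicTail_eq_add hin.le,
        thresholdValue_eq_add (k := k) hin, thresholdValue_eq_add (k := k + 1) hin]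
      push_cast
      field_simp
      ring
    rcases le_or_gt (crit n (k + 1)) (i + 1) with h | h
    · rw [GPos_of_crit_le h, ih2 h] at key
      have : selectionGain n k i = i * G n (k + 1) i := by linarith
      exact ⟨this.le, fun _ => this⟩
    · rw [GPos_of_lt_crit h] at key
      have := G_neg_of_lt_crit hn (by omega) h
      exact ⟨by linarith, fun h' => absurd h' (by omega)⟩

theorem selectionGain_eq_of_crit_le (hn : 1 ≤ n) {k i : ℕ} (hi : 1 ≤ i) (hin : i ≤ n)
    (h : crit n (k + 1) ≤ i) : selectionGain n k i = i * GPos n (k + 1) i := by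
  rw [GPos_of_crit_le h, (selectionGain_le hn hi hin).2 h]

theorem selectionGain_le_GPos (hn : 1 ≤ n) {k i : ℕ} (hi : 1 ≤ i) (hin : i ≤ n) :
    selectionGain n k i ≤ i * GPos n (k + 1) i := by
  rcases le_or_gt (crit n (k + 1)) i with h | h
  · exact (selectionGain_eq_of_crit_le hn hi hin h).le
  · rw [GPos_of_lt_crit h, mul_zero]
    exact (selectionGain_le hn hi hin).1.trans
      (mul_nonpos_of_nonneg_of_nonpos (by positivity) (G_neg_of_lt_crit hn hi h).le)

end Critical
/-! ### The mean total duration of an admissible vector of choices -/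

section Policies

variable {n k : ℕ}

/-- The number of choices made at time `t`. -/
def choicesAt (τ : Fin k → Equiv.Perm (Fin n) → ℕ) (t : ℕ) (σ : Equiv.Perm (Fin n)) : ℕ :=
  (Finset.univ.filter fun j => τ j σ = t).card

/-- The number of choices which remain after time `t`. -/
def choicesAfter (τ : Fin k → Equiv.Perm (Fin n) → ℕ) (t : ℕ) (σ : Equiv.Perm (Fin n)) : ℕ :=
  (Finset.univ.filter fun j => t < τ j σ).card

theorem choicesAfter_eq_add (τ : Fin k → Equiv.Perm (Fin n) → ℕ) (t : ℕ)
    (σ : Equiv.Perm (Fin n)) :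
    choicesAfter τ t σ = choicesAfter τ (t + 1) σ + choicesAt τ (t + 1) σ := by
  rw [choicesAfter, choicesAfter, choicesAt, ← Finset.card_union_of_disjoint]
  · congr 1
    ext j
    simp only [Finset.mem_filter, Finset.mem_univ, true_and, Finset.mem_union]
    omega
  · rw [Finset.disjoint_filter]
    intros
    omega

theorem measurableSet_rankFiltration_iff {t : ℕ} {A : Set (Equiv.Perm (Fin n))} :
    MeasurableSet[rankFiltration n t] A ↔ KnownAt t fun σ => σ ∈ A := by
  constructor
  · rintro ⟨B, -, rfl⟩ σ σ' h
    simp only [Set.mem_preimage, h]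
  · intro h
    refine ⟨history n t '' A, trivial, ?_⟩
    ext σ
    constructor
    · rintro ⟨σ', h1, h2⟩
      exact (h h2).mp h1
    · intro h1
      exact ⟨σ, h1, rfl⟩

theorem isStoppingTime_iff {τ : Equiv.Perm (Fin n) → ℕ} :
    IsStoppingTime (rankFiltration n) (fun σ => ((τ σ : ℕ) : WithTop ℕ)) ↔
      ∀ t, KnownAt t fun σ => τ σ ≤ t := by
  refine forall_congr' fun t => measurableSet_rankFiltration_iff.trans ?_
  have : (fun σ => σ ∈ {σ | ((τ σ : ℕ) : WithTop ℕ) ≤ (t : WithTop ℕ)}) = fun σ => τ σ ≤ t := by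
    funext σ
    exact propext WithTop.coe_le_coe
  rw [← this]
  rfl

namespace IsAdmissible

variable {i : ℕ} {τ : Fin k → Equiv.Perm (Fin n) → ℕ}

theorem knownAt_choicesAfter (h : IsAdmissible n i k τ) (t : ℕ) :
    KnownAt t (choicesAfter τ t) := by
  intro σ σ' hσ
  refine congrArg Finset.card (Finset.filter_congr fun j _ => ?_)
  rw [← not_le, ← not_le]
  exact not_congr (eq_iff_iff.1 (isStoppingTime_iff.1 (h.stopping j) t hσ))

theorem knownAt_choicesAt (h : IsAdmissible n i k τ) (t : ℕ) :
    KnownAt (t + 1) (choicesAt τ (t + 1)) := by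
  intro σ σ' hσ
  have h1 := h.knownAt_choicesAfter (t + 1) hσ
  have h2 := (h.knownAt_choicesAfter t).mono (Nat.le_succ t) hσ
  have h3 := choicesAfter_eq_add τ t σ
  have h4 := choicesAfter_eq_add τ t σ'
  omega

theorem le_succ (h : IsAdmissible n i k τ) (j : Fin k) (σ : Equiv.Perm (Fin n)) :
    τ j σ ≤ n + 1 := by
  rcases h.candidate j σ with h1 | h1
  · exact h1.le.trans (Nat.le_succ n)
  · exact h1.le

theorem choicesAfter_eq (h : IsAdmissible n (i + 1) k τ) (σ : Equiv.Perm (Fin n)) :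
    choicesAfter τ i σ = k := by
  have h1 : ∀ j ∈ Finset.univ, i < τ j σ := fun j _ => h.ge_start j σ
  rw [choicesAfter, Finset.filter_true_of_mem h1]
  simp

theorem choicesAt_le_one (h : IsAdmissible n i k τ) {t : ℕ} (ht : t ≤ n)
    (σ : Equiv.Perm (Fin n)) : choicesAt τ t σ ≤ 1 := by
  refine Finset.card_le_one.2 fun a ha b hb => ?_
  simp only [Finset.mem_filter, Finset.mem_univ, true_and] at ha hb
  rcases lt_trichotomy a b with h1 | h1 | h1
  · have := h.increasing a b h1 σ
    omega
  · exact h1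
  · have := h.increasing b a h1 σ
    omega

theorem isCandidate_of_choicesAt_ne_zero (h : IsAdmissible n i k τ) {t : ℕ} (ht : t ≤ n)
    {σ : Equiv.Perm (Fin n)} (h0 : choicesAt τ t σ ≠ 0) : IsCandidate σ t := by
  obtain ⟨j, hj⟩ := Finset.card_ne_zero.1 h0
  simp only [Finset.mem_filter, Finset.mem_univ, true_and] at hj
  rcases h.candidate j σ with h1 | h1
  · rwa [hj] at h1
  · omega

theorem payoff_eq (h : IsAdmissible n i k τ) (σ : Equiv.Perm (Fin n)) :
    payoff τ σ = ∑ t ∈ Finset.Icc i n, (choicesAt τ t σ : ℝ) * duration σ t := by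
  have h1 : ∀ t, (choicesAt τ t σ : ℝ) * duration σ t
      = ∑ j, if τ j σ = t then (duration σ (τ j σ) : ℝ) else 0 := by
    intro t
    rw [choicesAt, Finset.card_filter, Nat.cast_sum, Finset.sum_mul]
    refine Finset.sum_congr rfl fun j _ => ?_
    split_ifs with h
    · rw [h]
      simp
    · simp
  rw [Finset.sum_congr rfl fun t _ => h1 t, Finset.sum_comm, payoff]
  refine Finset.sum_congr rfl fun j _ => ?_
  rw [Finset.sum_ite_eq]
  split_ifs with h2
  · rfl
  · have h3 := h.ge_start j σ
    have h4 := h.le_succ j σ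
    rw [Finset.mem_Icc] at h2
    rw [show τ j σ = n + 1 by omega, duration_succ_self, Nat.cast_zero]

end IsAdmissible

/-- The mean total duration under the threshold rule, from time `t` on with `l` choices left, given
the relative ranks observed up to time `t`: these matter only through the presence of a candidate
at time `t`. -/
noncomputable def conditionalValue (l t : ℕ) (σ : Equiv.Perm (Fin n)) : ℝ :=
  ind (IsCandidate σ t) * (t * GPos n l t) + thresholdValue n l (t + 1)

/-- The loss in conditional mean which the decision at time `t` causes, if the threshold rule is
followed after time `t`. -/
noncomputable def decisionLoss (τ : Fin k → Equiv.Perm (Fin n) → ℕ) (t : ℕ)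
    (σ : Equiv.Perm (Fin n)) : ℝ :=
  conditionalValue (choicesAfter τ (t - 1) σ) t σ - choicesAt τ t σ * (t * harmonicTail n t)
    - thresholdValue n (choicesAfter τ t σ) (t + 1)

theorem sum_mul_conditionalValue {t : ℕ} (ht : t < n) {a : Equiv.Perm (Fin n) → ℝ}
    (ha : KnownAt t a) {l : Equiv.Perm (Fin n) → ℕ} (hl : KnownAt t l) :
    ∑ σ, a σ * conditionalValue (l σ) (t + 1) σ
      = ∑ σ, a σ * thresholdValue n (l σ) (t + 1) := by
  have hk : KnownAt t fun σ => a σ * ((t + 1 : ℕ) * GPos n (l σ) (t + 1)) := by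
    intro σ σ' h
    simp only [ha h, hl h]
  have h1 := sum_mul_candidate ht hk
  have h2 : ∀ σ, a σ * conditionalValue (l σ) (t + 1) σ
      = a σ * ((t + 1 : ℕ) * GPos n (l σ) (t + 1)) * ind (IsCandidate σ (t + 1))
        + a σ * thresholdValue n (l σ) (t + 1 + 1) := fun σ => by
    rw [conditionalValue]
    ring
  rw [Finset.sum_congr rfl fun σ _ => h2 σ, Finset.sum_add_distrib, h1, Finset.sum_div,
    ← Finset.sum_add_distrib]
  refine Finset.sum_congr rfl fun σ _ => ?_
  rw [thresholdValue_eq_add ht]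
  have : ((t : ℝ) + 1) ≠ 0 := by positivity
  push_cast
  field_simp

/-- Telescoping over the times after `t`: the mean of the durations of the objects selected then
falls short of the value of the threshold rule by the mean of the losses. -/
theorem IsAdmissible.sum_mul_choicesAt {i : ℕ} {τ : Fin k → Equiv.Perm (Fin n) → ℕ}
    (h : IsAdmissible n i k τ) {a : Equiv.Perm (Fin n) → ℝ} {t : ℕ} (ht : t ≤ n)
    (ha : KnownAt t a) :
    ∑ s ∈ Finset.Icc (t + 1) n, s * harmonicTail n s * ∑ σ, a σ * choicesAt τ s σ
      = ∑ σ, a σ * thresholdValue n (choicesAfter τ t σ) (t + 1)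
        - ∑ s ∈ Finset.Icc (t + 1) n, ∑ σ, a σ * decisionLoss τ s σ := by
  induction ht using Nat.decreasingInduction with
  | self => simp [thresholdValue_of_lt]
  | of_succ t ht ih =>
    have h2 : ∑ σ, a σ * decisionLoss τ (t + 1) σ
        = ∑ σ, a σ * thresholdValue n (choicesAfter τ t σ) (t + 1)
          - (t + 1 : ℕ) * harmonicTail n (t + 1) * ∑ σ, a σ * choicesAt τ (t + 1) σ
          - ∑ σ, a σ * thresholdValue n (choicesAfter τ (t + 1) σ) (t + 1 + 1) := by
      rw [← sum_mul_conditionalValue ht ha (h.knownAt_choicesAfter t), Finset.mul_sum,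
        ← Finset.sum_sub_distrib, ← Finset.sum_sub_distrib]
      refine Finset.sum_congr rfl fun σ _ => ?_
      rw [decisionLoss, Nat.add_sub_cancel]
      ring
    rw [sum_Icc_eq_add (by omega : t + 1 ≤ n), sum_Icc_eq_add (by omega : t + 1 ≤ n),
      ih (ha.mono (Nat.le_succ t)), h2]
    ring

theorem IsAdmissible.sum_mul_payoff {i : ℕ} {τ : Fin k → Equiv.Perm (Fin n) → ℕ}
    (h : IsAdmissible n (i + 1) k τ) (hi : i < n) {a : Equiv.Perm (Fin n) → ℝ}
    (ha : KnownAt (i + 1) a) :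
    ∑ σ, a σ * payoff τ σ
      = ∑ σ, a σ * conditionalValue k (i + 1) σ
        - ∑ s ∈ Finset.Icc (i + 1) n, ∑ σ, a σ * decisionLoss τ s σ := by
  have h1 : ∑ σ, a σ * payoff τ σ
      = ∑ s ∈ Finset.Icc (i + 1) n, s * harmonicTail n s * ∑ σ, a σ * choicesAt τ s σ := by
    have : ∀ σ, a σ * payoff τ σ
        = ∑ s ∈ Finset.Icc (i + 1) n, a σ * choicesAt τ s σ * duration σ s := fun σ => by
      rw [h.payoff_eq, Finset.mul_sum]
      exact Finset.sum_congr rfl fun s _ => by ring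
    rw [Finset.sum_congr rfl fun σ _ => this σ, Finset.sum_comm]
    refine Finset.sum_congr rfl fun s hs => ?_
    rw [Finset.mem_Icc] at hs
    refine sum_mul_duration (by omega) hs.2 fun σ σ' hσ => ?_
    obtain ⟨t, rfl⟩ : ∃ t, s = t + 1 := ⟨s - 1, by omega⟩
    simp only [ha.mono hs.1 hσ, h.knownAt_choicesAt t hσ]
  have h2 : ∑ σ, a σ * decisionLoss τ (i + 1) σ
      = ∑ σ, a σ * conditionalValue k (i + 1) σ
        - (i + 1 : ℕ) * harmonicTail n (i + 1) * ∑ σ, a σ * choicesAt τ (i + 1) σ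
        - ∑ σ, a σ * thresholdValue n (choicesAfter τ (i + 1) σ) (i + 1 + 1) := by
    rw [Finset.mul_sum, ← Finset.sum_sub_distrib, ← Finset.sum_sub_distrib]
    refine Finset.sum_congr rfl fun σ _ => ?_
    rw [decisionLoss, Nat.add_sub_cancel, h.choicesAfter_eq]
    ring
  rw [h1, sum_Icc_eq_add (by omega : i + 1 ≤ n), sum_Icc_eq_add (by omega : i + 1 ≤ n),
    h.sum_mul_choicesAt hi ha, h2]
  ring

theorem IsAdmissible.decisionLoss_nonneg {i : ℕ} {τ : Fin k → Equiv.Perm (Fin n) → ℕ}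
    (h : IsAdmissible n i k τ) {t : ℕ} (h1 : 1 ≤ t) (ht : t ≤ n) (σ : Equiv.Perm (Fin n)) :
    0 ≤ decisionLoss τ t σ := by
  obtain ⟨t, rfl⟩ : ∃ s, t = s + 1 := ⟨t - 1, by omega⟩
  have hn : 1 ≤ n := h1.trans ht
  have hle := h.choicesAt_le_one ht σ
  have hadd := choicesAfter_eq_add τ t σ
  rw [decisionLoss, conditionalValue, Nat.add_sub_cancel]
  by_cases h0 : choicesAt τ (t + 1) σ = 0
  · rw [h0, add_zero] at hadd
    rw [h0, hadd]
    have := mul_nonneg (ind_nonneg (IsCandidate σ (t + 1)))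
      (mul_nonneg (Nat.cast_nonneg (t + 1)) (GPos_nonneg hn (k := choicesAfter τ (t + 1) σ) ht))
    push_cast at this ⊢
    linarith
  · have hS : choicesAt τ (t + 1) σ = 1 := by omega
    rw [hS] at hadd
    rw [hS, hadd, ind_true (h.isCandidate_of_choicesAt_ne_zero ht h0)]
    have := selectionGain_le_GPos hn (k := choicesAfter τ (t + 1) σ) h1 ht
    rw [selectionGain] at this
    push_cast at this ⊢
    linarith

/-- No loss arises from a decision made according to the critical numbers. -/
theorem IsAdmissible.decisionLoss_eq_zero {i : ℕ} {τ : Fin k → Equiv.Perm (Fin n) → ℕ}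
    (h : IsAdmissible n i k τ) {t : ℕ} (ht : t < n) {σ : Equiv.Perm (Fin n)}
    (hrule : choicesAt τ (t + 1) σ ≠ 0 ↔ IsCandidate σ (t + 1) ∧ choicesAfter τ t σ ≠ 0 ∧
      crit n (choicesAfter τ t σ) ≤ t + 1) :
    decisionLoss τ (t + 1) σ = 0 := by
  have hn : 1 ≤ n := by omega
  have hle : choicesAt τ (t + 1) σ ≤ 1 := h.choicesAt_le_one ht σ
  have hadd := choicesAfter_eq_add τ t σ
  rw [decisionLoss, conditionalValue, Nat.add_sub_cancel]
  by_cases h0 : choicesAt τ (t + 1) σ = 0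
  · have hz : ind (IsCandidate σ (t + 1)) * GPos n (choicesAfter τ t σ) (t + 1) = 0 := by
      by_cases hc : IsCandidate σ (t + 1)
      · rw [GPos, if_neg fun h1 => hrule.2 ⟨hc, h1⟩ h0, mul_zero]
      · rw [ind_false hc, zero_mul]
    rw [h0, add_zero] at hadd
    rw [mul_left_comm, hz, h0, hadd]
    simp
  · have hS : choicesAt τ (t + 1) σ = 1 := by omega
    rw [hS] at hadd
    obtain ⟨hc, -, hcrit⟩ := hrule.1 h0
    rw [hadd] at hcrit
    rw [hS, hadd, ind_true hc]
    have := selectionGain_eq_of_crit_le hn (Nat.succ_le_succ (Nat.zero_le t)) ht hcrit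
    rw [selectionGain] at this
    push_cast at this ⊢
    linarith

/-! ### The threshold rule -/

section Threshold

variable (s : ℕ → ℕ) (i k : ℕ) (σ : Equiv.Perm (Fin n))

theorem thresholdTime_spec (j : ℕ) :
    IsCandidate σ (thresholdTime s i k σ j) ∨ thresholdTime s i k σ j = n + 1 := by
  cases j <;> exact (firstCandidateFrom_spec σ _).imp_left And.right

theorem thresholdTime_le (j : ℕ) : thresholdTime s i k σ j ≤ n + 1 := by
  cases j <;> exact firstCandidateFrom_le σ _

theorem thresholdTime_lt_succ (j : ℕ) :
    thresholdTime s i k σ j < thresholdTime s i k σ (j + 1) ∨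
      thresholdTime s i k σ (j + 1) = n + 1 :=
  (firstCandidateFrom_spec σ _).imp_left fun h => (le_max_left _ _).trans h.1

theorem thresholdTime_mono : Monotone (thresholdTime s i k σ) := by
  refine monotone_nat_of_le_succ fun j => ?_
  have := thresholdTime_le s i k σ j
  rcases thresholdTime_lt_succ s i k σ j with h | h <;> omega

theorem thresholdTime_lt_of_lt {j l : ℕ} (hjl : j < l) :
    thresholdTime s i k σ j < thresholdTime s i k σ l ∨ thresholdTime s i k σ l = n + 1 := by
  have h1 := thresholdTime_mono s i k σ (show j + 1 ≤ l from hjl)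
  have h2 := thresholdTime_le s i k σ l
  rcases thresholdTime_lt_succ s i k σ j with h | h <;> omega

theorem le_thresholdTime (hi : i ≤ n) (j : ℕ) : i ≤ thresholdTime s i k σ j := by
  refine le_trans ?_ (thresholdTime_mono s i k σ (Nat.zero_le j))
  rcases firstCandidateFrom_spec σ (max i (s k)) with h | h
  · exact (le_max_left _ _).trans h.1
  · rw [thresholdTime]
    omega

/-- When the first `j` choices have been made before time `t`, the next one is made at `t` if and
only if there is a candidate at a time `t` not before the critical number. -/
theorem thresholdTime_eq_iff {j t : ℕ} (hit : i ≤ t) (ht : t ≤ n)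
    (hlt : ∀ l < j, thresholdTime s i k σ l < t) (hle : t ≤ thresholdTime s i k σ j) :
    thresholdTime s i k σ j = t ↔ IsCandidate σ t ∧ s (k - j) ≤ t := by
  obtain ⟨a, ha, he⟩ : ∃ a ≤ t, thresholdTime s i k σ j
      = firstCandidateFrom σ (max a (s (k - j))) := by
    cases j with
    | zero => exact ⟨i, hit, rfl⟩
    | succ j => exact ⟨_, hlt j (Nat.lt_succ_self j), rfl⟩
  rw [he] at hle ⊢
  constructor
  · intro h
    rcases firstCandidateFrom_spec σ (max a (s (k - j))) with h1 | h1
    · rw [h] at h1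
      exact ⟨h1.2, (le_max_right _ _).trans h1.1⟩
    · omega
  · rintro ⟨h1, h2⟩
    exact le_antisymm (firstCandidateFrom_le_of_isCandidate (max_le ha h2) h1) hle

theorem firstCandidateFrom_congr {t a : ℕ} {σ σ' : Equiv.Perm (Fin n)}
    (h : history n t σ = history n t σ') (ha : firstCandidateFrom σ a ≤ t) :
    firstCandidateFrom σ' a = firstCandidateFrom σ a := by
  have key : ∀ r ≤ t, IsCandidate σ r = IsCandidate σ' r := fun r hr => knownAt_isCandidate hr h
  refine le_antisymm ?_ ?_
  · rcases firstCandidateFrom_spec σ a with h1 | h1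
    · exact firstCandidateFrom_le_of_isCandidate h1.1 ((key _ ha).mp h1.2)
    · rw [h1]
      exact firstCandidateFrom_le _ _
  · by_contra hlt
    rcases firstCandidateFrom_spec σ' a with h1 | h1
    · exact hlt (firstCandidateFrom_le_of_isCandidate h1.1
        ((key _ (by omega)).mpr h1.2))
    · have := firstCandidateFrom_le σ a
      omega

theorem thresholdTime_congr {t : ℕ} {σ σ' : Equiv.Perm (Fin n)}
    (h : history n t σ = history n t σ') (j : ℕ) (hj : thresholdTime s i k σ j ≤ t) :
    thresholdTime s i k σ' j = thresholdTime s i k σ j := by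
  induction j with
  | zero => exact firstCandidateFrom_congr h hj
  | succ j ih =>
    have h1 := ih ((thresholdTime_mono s i k σ (Nat.le_succ j)).trans hj)
    rw [thresholdTime, h1]
    exact firstCandidateFrom_congr h hj

theorem isAdmissible_thresholdRule (n : ℕ) (s : ℕ → ℕ) {i : ℕ} (hi : i ≤ n) (k : ℕ) :
    IsAdmissible n i k (thresholdRule n s i k) where
  stopping j := isStoppingTime_iff.2 fun t σ σ' h => by
    have key : ∀ {σ σ' : Equiv.Perm (Fin n)}, history n t σ = history n t σ' →
        thresholdRule n s i k j σ ≤ t → thresholdRule n s i k j σ' ≤ t := fun h hj =>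
      (thresholdTime_congr s i k h j hj).trans_le hj
    exact propext ⟨key h, key h.symm⟩
  ge_start j σ := le_thresholdTime s i k σ hi j
  candidate j σ := thresholdTime_spec s i k σ j
  increasing _ _ hjl σ := thresholdTime_lt_of_lt s i k σ hjl

/-- The threshold rule selects at time `t + 1` if and only if there is a candidate, a choice
remains, and the critical number for the choices which remain has been reached. -/
theorem choicesAt_thresholdRule {t : ℕ} (hit : i ≤ t + 1) (ht : t < n) :
    choicesAt (thresholdRule n s i k) (t + 1) σ ≠ 0 ↔ IsCandidate σ (t + 1) ∧
      choicesAfter (thresholdRule n s i k) t σ ≠ 0 ∧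
      s (choicesAfter (thresholdRule n s i k) t σ) ≤ t + 1 := by
  set q := thresholdTime s i k σ with hq
  have hS : choicesAt (thresholdRule n s i k) (t + 1) σ ≠ 0 ↔ ∃ j < k, q j = t + 1 := by
    rw [choicesAt, Finset.card_ne_zero]
    constructor
    · rintro ⟨j, hj⟩
      exact ⟨j, j.2, (Finset.mem_filter.1 hj).2⟩
    · rintro ⟨j, hj, h⟩
      exact ⟨⟨j, hj⟩, Finset.mem_filter.2 ⟨Finset.mem_univ _, h⟩⟩
  have hK : choicesAfter (thresholdRule n s i k) t σ ≠ 0 ↔ ∃ j < k, t < q j := by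
    rw [choicesAfter, Finset.card_ne_zero]
    constructor
    · rintro ⟨j, hj⟩
      exact ⟨j, j.2, (Finset.mem_filter.1 hj).2⟩
    · rintro ⟨j, hj, h⟩
      exact ⟨⟨j, hj⟩, Finset.mem_filter.2 ⟨Finset.mem_univ _, h⟩⟩
  rw [hS, hK]
  by_cases hex : ∃ j, j < k ∧ t < q j
  · -- `c` is the number of choices made up to time `t`
    obtain ⟨hck, hcq⟩ := Nat.find_spec hex
    set c := Nat.find hex with hc
    have hmin : ∀ l < c, q l < t + 1 := fun l hl => by
      have := Nat.find_min hex hl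
      have hlk : l < k := hl.trans hck
      omega
    have hcard : choicesAfter (thresholdRule n s i k) t σ = k - c := by
      have : (Finset.univ.filter fun j : Fin k => t < thresholdRule n s i k j σ)
          = Finset.Ici ⟨c, hck⟩ := by
        ext j
        simp only [Finset.mem_filter, Finset.mem_univ, true_and, Finset.mem_Ici, Fin.le_def]
        constructor
        · intro h
          by_contra h1
          exact absurd (hmin j (not_le.1 h1)) (not_lt.2 h)
        · intro h
          exact hcq.trans_le (thresholdTime_mono s i k σ h)
      rw [choicesAfter, this, Fin.card_Ici]
    have hiff := thresholdTime_eq_iff s i k σ hit ht hmin hcq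
    rw [hcard]
    refine Iff.trans ⟨?_, fun h => ⟨c, hck, h⟩⟩
      (hiff.trans (and_congr_right fun _ => (and_iff_right hex).symm))
    rintro ⟨j, hj, h⟩
    have h1 : c ≤ j := Nat.find_min' hex ⟨hj, by omega⟩
    rcases Nat.lt_or_eq_of_le h1 with h2 | h2
    · have := thresholdTime_lt_of_lt s i k σ h2
      rw [← hq] at this
      omega
    · rw [h2]
      exact h
  · refine iff_of_false ?_ fun h => hex h.2.1
    rintro ⟨j, hj, h⟩
    exact hex ⟨j, hj, by omega⟩

end Threshold

/-! ### Optimality -/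

/-- It suffices to compare integrals over the events observable at time `i`. -/
theorem condExp_le_condExp_of_sum_le {i : ℕ} {X Y : Equiv.Perm (Fin n) → ℝ}
    (h : ∀ A : Set (Equiv.Perm (Fin n)), KnownAt i (fun σ => ind (σ ∈ A)) →
      ∑ σ, ind (σ ∈ A) * X σ ≤ ∑ σ, ind (σ ∈ A) * Y σ) :
    (orderLaw n)[X | rankFiltration n i] ≤ᵐ[orderLaw n] (orderLaw n)[Y | rankFiltration n i] := by
  have hm := (rankFiltration n).le i
  refine ae_le_of_ae_le_trim (hm := hm) (ae_le_of_forall_setIntegral_le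
    (integrable_condExp.trim hm stronglyMeasurable_condExp)
    (integrable_condExp.trim hm stronglyMeasurable_condExp) fun A hA _ => ?_)
  rw [← setIntegral_trim hm stronglyMeasurable_condExp hA,
    ← setIntegral_trim hm stronglyMeasurable_condExp hA,
    setIntegral_condExp hm Integrable.of_finite hA, setIntegral_condExp hm Integrable.of_finite hA,
    setIntegral_orderLaw, setIntegral_orderLaw]
  refine mul_le_mul_of_nonneg_left (h A fun σ σ' hσ => ?_) (by positivity)
  exact congrArg ind (measurableSet_rankFiltration_iff.1 hA hσ)

theorem isOptimalFrom_thresholdRule {i : ℕ} (hi : 1 ≤ i) (hin : i ≤ n) (k : ℕ) :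
    IsOptimalFrom n i k (thresholdRule n (crit n) i k) := by
  have hadm := isAdmissible_thresholdRule n (crit n) hin k
  refine ⟨hadm, fun τ hτ => condExp_le_condExp_of_sum_le fun A hA => ?_⟩
  obtain ⟨i, rfl⟩ : ∃ t, i = t + 1 := ⟨i - 1, by omega⟩
  rw [hτ.sum_mul_payoff hin hA, hadm.sum_mul_payoff hin hA]
  refine sub_le_sub_left (Finset.sum_le_sum fun t ht => Finset.sum_le_sum fun σ _ => ?_) _
  rw [Finset.mem_Icc] at ht
  obtain ⟨t, rfl⟩ : ∃ r, t = r + 1 := ⟨t - 1, by omega⟩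
  beta_reduce
  rw [hadm.decisionLoss_eq_zero ht.2 (choicesAt_thresholdRule (crit n) (i + 1) k σ ht.1 ht.2),
    mul_zero]
  exact mul_nonneg (ind_nonneg _) (hτ.decisionLoss_nonneg (by omega) ht.2 σ)

theorem IsOptimalFrom.isOptimal {τ : Fin k → Equiv.Perm (Fin n) → ℕ}
    (h : IsOptimalFrom n 1 k τ) : IsOptimal n k τ := by
  refine ⟨h.1, fun τ' hτ' => ?_⟩
  have hm := (rankFiltration n).le 1
  rw [← integral_condExp hm (f := payoff τ'), ← integral_condExp hm (f := payoff τ)]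
  exact integral_mono_ae integrable_condExp integrable_condExp (h.2 τ' hτ')

end Policies
end DurationProblem

theorem corollary1 (n m : ℕ) (hm : 1 ≤ m) (hmn : m < n) :
    -- the critical numbers are well defined, lie in `{1, …, n}` and are nonincreasing
    (∀ k, 1 ≤ k → k ≤ m →
      IsLeast {i | 1 ≤ i ∧ i ≤ n ∧ 0 ≤ DurationProblem.G n k i} (DurationProblem.crit n k)) ∧
    (∀ k, 1 ≤ k → k < m → DurationProblem.crit n (k + 1) ≤ DurationProblem.crit n k) ∧
    -- the threshold rule solves the `m`-choice problem
    DurationProblem.IsOptimal n m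
      (DurationProblem.thresholdRule n (DurationProblem.crit n) 1 m) ∧
    -- it is optimal from every time on, for every number of choices left and every history
    (∀ i, 1 ≤ i → i ≤ n → ∀ k, 1 ≤ k → k ≤ m →
      DurationProblem.IsOptimalFrom n i k
        (DurationProblem.thresholdRule n (DurationProblem.crit n) i k)) := by
  have hn : 1 ≤ n := hm.trans hmn.le
  refine ⟨fun k hk _ => ?_, fun k hk _ => ?_,
    (DurationProblem.isOptimalFrom_thresholdRule le_rfl hn m).isOptimal,
    fun i hi hin k _ _ => DurationProblem.isOptimalFrom_thresholdRule hi hin k⟩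
  · obtain ⟨l, rfl⟩ : ∃ l, k = l + 1 := ⟨k - 1, by omega⟩
    exact DurationProblem.isLeast_crit hn l
  · obtain ⟨l, rfl⟩ : ∃ l, k = l + 1 := ⟨k - 1, by omega⟩
    exact DurationProblem.crit_succ_le hn l
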